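/- Let $H$ be a separable complex Hilbert space, and let $A$ be a bounded non-negative self-adjoint operator on $H$ with $\ker A=\{0\}$ and $\operatorname{ran}A\neq H$ (so that $H$ is necessarily infinite-dimensional). Below, "subspace" means closed linear subspace, $P_{L}$ is the orthogonal projection of $H$ onto a subspace $L$, and $T^{1/2}$ is the non-negative square root of a bounded non-negative operator $T$. Then there are a subspace $M\subset H$ with $$M\cap\operatorname{ran}A^{1/2}=M^\perp\cap\operatorname{ran}A^{1/2}=\{0\}$$ and a strictly increasing sequence $N_1\subsetneq N_2\subsetneq\cdots$ of subspaces of $H$ such that 1. $N_k\cap\operatorname{ran}A^{1/2}=N_k^\perp\cap\operatorname{ran}A^{1/2}=\{0\}$ for all $k\ge 1$; 2. $\bigcap_{k\ge1}N_k^\perp=\{0\}$; 3. $P_{N_k}\to I$ strongly, i.e. $P_{N_k}x\to x$ for every $x\in H$; 4. the chain is generated by $M$ as follows: $N_1=M^\perp$ and, with $A_0:=A$ and $A_k:=A_{k-1}^{1/2}P_{M}A_{k-1}^{1/2}$ for $k\ge1$, one has $A_k=A^{1/2}P_{N_k^\perp}A^{1/2}$ for all $k\ge1$. -/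

import Mathlib

open Filter Topology

noncomputable section

variable {H : Type*} [NormedAddCommGroup H] [InnerProductSpace ℂ H] [CompleteSpace H]

/-- `A` belongs to `B₀⁺(H)`: a bounded non-negative self-adjoint operator with trivial kernel. -/
def IsNonsingularPositive (A : H →L[ℂ] H) : Prop :=
  A.IsPositive ∧ A.ker = ⊥

/-- The non-negative square root of a bounded non-negative operator `A`. -/
def opSqrt (A : H →L[ℂ] H) : H →L[ℂ] H := CFC.sqrt A

/-- The orthogonal projection `P_M`, as an operator on `H`, onto a closed subspace `M`. -/
def projOn (M : ClosedSubmodule ℂ H) : H →L[ℂ] H := M.toSubmodule.starProjection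

/-- `M ∩ ran A^{1/2} = M^⊥ ∩ ran A^{1/2} = {0}`. -/
def HasTrivialIntersections (A : H →L[ℂ] H) (M : ClosedSubmodule ℂ H) : Prop :=
  M.toSubmodule ⊓ (opSqrt A).range = ⊥ ∧ (Mᗮ).toSubmodule ⊓ (opSqrt A).range = ⊥

/-- The iteration `A_0 = A`, `A_k = A_{k-1}^{1/2} P_M A_{k-1}^{1/2}` for `k ≥ 1`. -/
def iterOp (A : H →L[ℂ] H) (M : ClosedSubmodule ℂ H) : ℕ → (H →L[ℂ] H)
  | 0 => A
  | k + 1 => opSqrt (iterOp A M k) ∘L projOn M ∘L opSqrt (iterOp A M k)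

end

section

/-! ### Subspaces that meet an operator range trivially -/

variable {H : Type*} [NormedAddCommGroup H] [InnerProductSpace ℂ H]

/-! Put S = A^{1/2}: injective, with dense range, not onto. Both M and Mᗮ miss ran S once S maps
each of them onto a dense set; a greedily built orthogonal sequence achieves this
(`exists_orthogonal_sequence`). If B = (S P_L S)^{1/2}, then ‖Bx‖ = ‖P_L S x‖, so B = S W with W an
isometry into L, and B P_M B = S P_{W(M)} S: the iteration replaces L by W(M)
(`exists_lt_conj_projOn_eq`). The roots B_k decrease strongly to some G. Since ‖P_M B_k x‖ =
‖B_{k+1} x‖, ran G lies in M; since ‖Gx‖ ≤ ‖Sx‖, it lies in ran S. Hence G = 0 and the L_k intersect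
in zero (`iInf_eq_bot_of_conj_projOn_eq`). Finally N_k = L_kᗮ. -/

lemma sup_span_singleton_inf_eq_bot {F R : Submodule ℂ H} (hF : F ⊓ R = ⊥) {z : H}
    (hz : z ∉ F ⊔ R) : (F ⊔ Submodule.span ℂ {z}) ⊓ R = ⊥ := by
  rw [Submodule.eq_bot_iff]
  rintro y ⟨hy, hyR⟩
  obtain ⟨f, hf, g, hg, rfl⟩ := Submodule.mem_sup.1 hy
  obtain ⟨c, rfl⟩ := Submodule.mem_span_singleton.1 hg
  rcases eq_or_ne c 0 with rfl | hc
  · have : f + (0 : ℂ) • z ∈ F ⊓ R := ⟨by simpa using hf, hyR⟩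
    rwa [hF] at this
  · refine absurd ?_ hz
    have : z = c⁻¹ • (-f + (f + c • z)) := by simp [hc]
    rw [this]
    exact Submodule.smul_mem _ _
      (add_mem (Submodule.mem_sup_left (neg_mem hf)) (Submodule.mem_sup_right hyR))

lemma inf_range_eq_bot_of_dense_map {T : H →L[ℂ] H} (hT : T.IsPositive) {M : Submodule ℂ H}
    (hd : Dense (T '' (Mᗮ : Set H))) : M ⊓ T.range = ⊥ := by
  rw [Submodule.eq_bot_iff]
  rintro _ ⟨hM, w, rfl⟩
  have h0 : w = 0 := by
    refine hd.eq_zero_of_inner_left (𝕜 := ℂ) ?_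
    rintro _ ⟨u, hu, rfl⟩
    rw [← hT.inner_left_eq_inner_right]
    exact hu _ hM
  simp [h0]

variable [CompleteSpace H]

lemma denseRange_of_ker_eq_bot {T : H →L[ℂ] H} (hT : T.IsPositive) (hker : T.ker = ⊥) :
    DenseRange T := by
  have h : T.range.topologicalClosure = ⊤ := by
    rw [Submodule.topologicalClosure_eq_top_iff, T.orthogonal_range,
      hT.isSelfAdjoint.adjoint_eq, hker]
  exact Submodule.dense_iff_topologicalClosure_eq_top.2 h

/-- If `F ∩ ran T = 0` for a self-adjoint injective `T`, then `T` maps `Fᗮ` onto a dense subspace. -/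
lemma dense_map_orthogonal {T : H →L[ℂ] H} (hT : T.IsPositive) (hker : T.ker = ⊥)
    {F : Submodule ℂ H} [F.HasOrthogonalProjection] (hF : F ⊓ T.range = ⊥) :
    Dense (Submodule.map (T : H →ₗ[ℂ] H) Fᗮ : Set H) := by
  rw [Submodule.dense_iff_topologicalClosure_eq_top, Submodule.topologicalClosure_eq_top_iff,
    Submodule.eq_bot_iff]
  intro w hw
  have h1 : T w ∈ F := by
    rw [← Submodule.orthogonal_orthogonal F]
    intro u hu
    have := hw (T u) (Submodule.mem_map_of_mem hu)
    rwa [hT.inner_left_eq_inner_right] at this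
  have h2 : T w ∈ F ⊓ T.range := ⟨h1, w, rfl⟩
  rw [hF] at h2
  have h3 : w ∈ T.ker := h2
  rwa [hker] at h3

/-- Otherwise ran T has a finite-dimensional complement, hence is closed; being dense, it is all of
H. -/
lemma exists_notMem_sup_range {T : H →L[ℂ] H} (hT : T.IsPositive) (hker : T.ker = ⊥)
    (hran : T.range ≠ ⊤) {F : Submodule ℂ H} [FiniteDimensional ℂ F] (hF : F ⊓ T.range = ⊥) :
    ∃ w ∈ Fᗮ, w ∉ F ⊔ T.range := by
  by_contra! h
  have htop : F ⊔ T.range = ⊤ := by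
    rw [eq_top_iff, ← Submodule.sup_orthogonal_of_hasOrthogonalProjection (K := F)]
    exact sup_le le_sup_left h
  have hc : IsCompl T.range F :=
    ⟨disjoint_iff.2 (by rwa [inf_comm]), codisjoint_iff.2 (by rwa [sup_comm])⟩
  have hcl := T.closed_complemented_range_of_isCompl_of_ker_eq_bot F hc
    F.closed_of_finiteDimensional hker
  apply hran
  have hd := denseRange_of_ker_eq_bot hT hker
  rw [eq_top_iff]
  intro x _
  have := hcl.closure_eq ▸ hd x
  exact this

lemma exists_orthogonal_extension {T : H →L[ℂ] H} (hT : T.IsPositive) (hker : T.ker = ⊥)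
    (hran : T.range ≠ ⊤) {F : Submodule ℂ H} [FiniteDimensional ℂ F] (hF : F ⊓ T.range = ⊥)
    {U : Set H} (hU : IsOpen U) (hne : U.Nonempty) :
    ∃ z ∈ Fᗮ, T z ∈ U ∧ (F ⊔ Submodule.span ℂ {z}) ⊓ T.range = ⊥ := by
  obtain ⟨_, ⟨z₀, hz₀, rfl⟩, hyU⟩ := (dense_map_orthogonal hT hker hF).exists_mem_open hU hne
  obtain ⟨w, hw, hwn⟩ := exists_notMem_sup_range hT hker hran hF
  by_cases hz : z₀ ∈ F ⊔ T.range
  -- A small nonzero multiple of `w` moves `z₀` out of F + ran T while its image stays in `U`.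
  · have hcont : Continuous fun t : ℂ => T (z₀ + t • w) := by fun_prop
    have hnhds : ∀ᶠ t in 𝓝 (0 : ℂ), T (z₀ + t • w) ∈ U :=
      hcont.continuousAt.eventually (hU.mem_nhds (by simpa using hyU))
    obtain ⟨t, ht, ht0⟩ :=
      ((hnhds.filter_mono nhdsWithin_le_nhds).and (self_mem_nhdsWithin (s := {0}ᶜ))).exists
    refine ⟨z₀ + t • w, add_mem hz₀ (Submodule.smul_mem _ _ hw), ht,
      sup_span_singleton_inf_eq_bot hF fun h => hwn ?_⟩
    have h1 : t • w ∈ F ⊔ T.range := by simpa using sub_mem h hz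
    exact ((F ⊔ T.range).smul_mem_iff ht0).1 h1
  · exact ⟨z₀, hz₀, hyU, sup_span_singleton_inf_eq_bot hF hz⟩

lemma exists_orthogonal_sequence {T : H →L[ℂ] H} (hT : T.IsPositive) (hker : T.ker = ⊥)
    (hran : T.range ≠ ⊤) {U : ℕ → Set H} (hU : ∀ n, IsOpen (U n)) (hne : ∀ n, (U n).Nonempty) :
    ∃ v : ℕ → H, (∀ m n, m < n → inner ℂ (v m) (v n) = 0) ∧ ∀ n, T (v n) ∈ U n := by
  let X := {F : Submodule ℂ H // FiniteDimensional ℂ F ∧ F ⊓ T.range = ⊥}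
  have step : ∀ (F : X) (n : ℕ), ∃ z ∈ F.1ᗮ, T z ∈ U n ∧
      (F.1 ⊔ Submodule.span ℂ {z}) ⊓ T.range = ⊥ := fun F n =>
    have := F.2.1
    exists_orthogonal_extension hT hker hran F.2.2 (hU n) (hne n)
  choose z hz hzU hzF using step
  let F : ℕ → X := fun n => Nat.rec ⟨⊥, inferInstance, bot_inf_eq _⟩
    (fun n F => ⟨F.1 ⊔ Submodule.span ℂ {z F n},
      have := F.2.1; inferInstance, hzF F n⟩) n
  have hsucc : ∀ n, (F (n + 1)).1 = (F n).1 ⊔ Submodule.span ℂ {z (F n) n} := fun n => rfl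
  have hmono : Monotone fun n => (F n).1 :=
    monotone_nat_of_le_succ fun n => by rw [hsucc]; exact le_sup_left
  refine ⟨fun n => z (F n) n, fun m n hmn => hz (F n) n _ (hmono hmn ?_), fun n => hzU _ _⟩
  change _ ∈ (F (m + 1)).1
  rw [hsucc]
  exact Submodule.mem_sup_right (Submodule.mem_span_singleton_self _)

/-- A non-surjective injective positive operator on a separable space admits a closed subspace
that, together with its orthogonal complement, meets the range only in zero. -/
lemma exists_closedSubmodule_inf_range_eq_bot [TopologicalSpace.SeparableSpace H]
    {T : H →L[ℂ] H} (hT : T.IsPositive) (hker : T.ker = ⊥) (hran : T.range ≠ ⊤) :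
    ∃ M : ClosedSubmodule ℂ H,
      M.toSubmodule ⊓ T.range = ⊥ ∧ (Mᗮ).toSubmodule ⊓ T.range = ⊥ := by
  have : SecondCountableTopology H := UniformSpace.secondCountable_of_separable H
  have hB := TopologicalSpace.isBasis_countableBasis H
  have hBne : (TopologicalSpace.countableBasis H).Nonempty := by
    obtain ⟨u, hu, -⟩ := hB.exists_subset_of_mem_open (Set.mem_univ (0 : H)) isOpen_univ
    exact ⟨u, hu⟩
  obtain ⟨U, hU⟩ := (TopologicalSpace.countable_countableBasis H).exists_eq_range hBne
  have hmem : ∀ n, U n ∈ TopologicalSpace.countableBasis H := fun n => hU ▸ ⟨n, rfl⟩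
  -- The index `n / 2` visits each basic open set twice: even terms will span `M`, odd terms lie in
  -- `Mᗮ`.
  obtain ⟨v, hv, hvU⟩ := exists_orthogonal_sequence hT hker hran (U := fun n => U (n / 2))
    (fun n => TopologicalSpace.isOpen_of_mem_countableBasis (hmem _))
    (fun n => TopologicalSpace.nonempty_of_mem_countableBasis (hmem _))
  have horth : ∀ m n, m ≠ n → inner ℂ (v m) (v n) = 0 := fun m n hmn => by
    rcases hmn.lt_or_gt with h | h
    · exact hv m n h
    · exact inner_eq_zero_symm.1 (hv n m h)
  have hdense : ∀ (K : Submodule ℂ H) (i : ℕ), i < 2 → (∀ n, v (2 * n + i) ∈ K) →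
      Dense (T '' (K : Set H)) := fun K i hi hK => by
    rw [hB.dense_iff]
    intro o ho _
    obtain ⟨n, rfl⟩ : o ∈ Set.range U := hU ▸ ho
    refine ⟨_, ?_, _, hK n, rfl⟩
    have := hvU (2 * n + i)
    rwa [show (2 * n + i) / 2 = n by omega] at this
  let M : ClosedSubmodule ℂ H := (Submodule.span ℂ (Set.range fun n => v (2 * n))).closure
  have hM : ∀ n, v (2 * n) ∈ M.toSubmodule := fun n =>
    Submodule.le_topologicalClosure _ (Submodule.subset_span ⟨n, rfl⟩)
  have hM' : ∀ n, v (2 * n + 1) ∈ M.toSubmoduleᗮ := fun n => by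
    change _ ∈ (Submodule.span ℂ (Set.range fun n => v (2 * n))).topologicalClosureᗮ
    rw [Submodule.orthogonal_closure, Submodule.mem_orthogonal]
    intro u hu
    induction hu using Submodule.span_induction with
    | mem x hx => obtain ⟨m, rfl⟩ := hx; exact horth _ _ (by omega)
    | zero => simp
    | add x y _ _ hx hy => rw [inner_add_left, hx, hy, add_zero]
    | smul c x _ hx => rw [inner_smul_left, hx, mul_zero]
  refine ⟨M, inf_range_eq_bot_of_dense_map hT (hdense _ 1 (by norm_num) hM'),
    inf_range_eq_bot_of_dense_map hT ?_⟩
  rw [ClosedSubmodule.toSubmodule_orthogonal_eq, Submodule.orthogonal_orthogonal]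
  exact hdense _ 0 (by norm_num) hM

/-! ### Square roots of compressions S P_L S -/

lemma opSqrt_isPositive (A : H →L[ℂ] H) : (opSqrt A).IsPositive :=
  (ContinuousLinearMap.nonneg_iff_isPositive _).1 (CFC.sqrt_nonneg A)

lemma opSqrt_comp_opSqrt {A : H →L[ℂ] H} (hA : A.IsPositive) : opSqrt A ∘L opSqrt A = A :=
  CFC.sqrt_mul_sqrt_self A ((ContinuousLinearMap.nonneg_iff_isPositive _).2 hA)

lemma opSqrt_opSqrt_apply {A : H →L[ℂ] H} (hA : A.IsPositive) (x : H) :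
    opSqrt A (opSqrt A x) = A x :=
  congr($(opSqrt_comp_opSqrt hA) x)

lemma isPositive_conj_projOn {S : H →L[ℂ] H} (hS : S.IsPositive) (L : ClosedSubmodule ℂ H) :
    (S ∘L projOn L ∘L S).IsPositive := by
  have h := (ContinuousLinearMap.IsPositive.of_isStarProjection
    (isStarProjection_starProjection (U := L.toSubmodule))).conj_adjoint S
  rwa [hS.isSelfAdjoint.adjoint_eq] at h

lemma norm_opSqrt_conj_projOn {S : H →L[ℂ] H} (hS : S.IsPositive) (L : ClosedSubmodule ℂ H)
    (x : H) : ‖opSqrt (S ∘L projOn L ∘L S) x‖ = ‖projOn L (S x)‖ := by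
  have h1 : inner ℂ (opSqrt (S ∘L projOn L ∘L S) x) (opSqrt (S ∘L projOn L ∘L S) x) =
      inner ℂ (projOn L (S x)) (projOn L (S x)) := by
    rw [(opSqrt_isPositive _).inner_left_eq_inner_right,
      opSqrt_opSqrt_apply (isPositive_conj_projOn hS L)]
    simp only [ContinuousLinearMap.comp_apply]
    rw [← hS.inner_left_eq_inner_right, projOn, Submodule.inner_starProjection_left_eq_right,
      Submodule.starProjection_eq_self_iff.2 (Submodule.starProjection_apply_mem _ _)]
  rw [inner_self_eq_norm_sq_to_K, inner_self_eq_norm_sq_to_K] at h1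
  exact (pow_left_inj₀ (norm_nonneg _) (norm_nonneg _) two_ne_zero).1 (by exact_mod_cast h1)

lemma projOn_apply_eq_zero_iff {L : ClosedSubmodule ℂ H} {x : H} :
    projOn L x = 0 ↔ x ∈ L.toSubmoduleᗮ :=
  Submodule.starProjection_apply_eq_zero_iff _

lemma projOn_eq_of_mem_of_inner_eq_zero {L : ClosedSubmodule ℂ H} {x y : H} (hy : y ∈ L)
    (h : ∀ z ∈ L, inner ℂ z (x - y) = 0) : projOn L x = y :=
  Submodule.eq_starProjection_of_mem_of_inner_eq_zero hy fun z hz =>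
    inner_eq_zero_symm.1 (h z hz)

lemma ker_opSqrt_conj_projOn {S : H →L[ℂ] H} (hS : S.IsPositive) (hker : S.ker = ⊥)
    {L : ClosedSubmodule ℂ H} (hL : L.toSubmoduleᗮ ⊓ S.range = ⊥) :
    (opSqrt (S ∘L projOn L ∘L S)).ker = ⊥ := by
  rw [Submodule.eq_bot_iff]
  intro x hx
  have h0 : opSqrt (S ∘L projOn L ∘L S) x = 0 := hx
  have h1 : projOn L (S x) = 0 := by
    rw [← norm_eq_zero, ← norm_opSqrt_conj_projOn hS, h0, norm_zero]
  have h2 : S x ∈ L.toSubmoduleᗮ ⊓ S.range := ⟨projOn_apply_eq_zero_iff.1 h1, x, rfl⟩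
  rw [hL] at h2
  have h3 : x ∈ S.ker := h2
  rwa [hker] at h3

/-- The partial isometry of the polar decomposition of `P_L S`, when it is an isometry. -/
lemma exists_linearIsometry_conj_projOn {S : H →L[ℂ] H} (hS : S.IsPositive) (hker : S.ker = ⊥)
    {L : ClosedSubmodule ℂ H} (hL : L.toSubmoduleᗮ ⊓ S.range = ⊥) :
    ∃ W : H →ₗᵢ[ℂ] H, (∀ x, W x ∈ L.toSubmodule) ∧
      ∀ x, opSqrt (S ∘L projOn L ∘L S) x = S (W x) := by
  set B := opSqrt (S ∘L projOn L ∘L S)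
  have hB : B.IsPositive := opSqrt_isPositive _
  have hnorm : ∀ x, ‖B x‖ = ‖projOn L (S x)‖ := norm_opSqrt_conj_projOn hS L
  have hd : DenseRange (B : H →ₗ[ℂ] H) :=
    denseRange_of_ker_eq_bot hB (ker_opSqrt_conj_projOn hS hker hL)
  let f : H →ₗ[ℂ] H := (projOn L ∘L S : H →L[ℂ] H)
  let W₀ : H →L[ℂ] H := f.extendOfNorm (B : H →ₗ[ℂ] H)
  have hW : ∀ x, W₀ (B x) = projOn L (S x) :=
    LinearMap.extendOfNorm_eq hd ⟨1, fun x => by rw [one_mul]; exact (hnorm x).ge⟩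
  have hWn : ∀ x, ‖W₀ x‖ = ‖x‖ := fun x =>
    hd.induction_on (p := fun x => ‖W₀ x‖ = ‖x‖) x (isClosed_eq (by fun_prop) (by fun_prop))
      fun y => by
        change ‖W₀ (B y)‖ = ‖B y‖
        rw [hW, hnorm]
  let W : H →ₗᵢ[ℂ] H := ⟨W₀, hWn⟩
  have hWL : ∀ x, W x ∈ L.toSubmodule := fun x =>
    hd.induction_on (p := fun x => W x ∈ L.toSubmodule) x
      (L.isClosed.preimage W.continuous) fun y => by
        change W₀ (B y) ∈ _
        rw [hW]
        exact Submodule.starProjection_apply_mem _ _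
  -- Adjoint form of W B = P_L S: ⟨Wx, Sy⟩ = ⟨Wx, P_L S y⟩ = ⟨Wx, W B y⟩ = ⟨x, By⟩.
  refine ⟨W, hWL, fun x => ext_inner_right ℂ fun y => ?_⟩
  rw [hS.inner_left_eq_inner_right, hB.inner_left_eq_inner_right,
    ← Submodule.starProjection_eq_self_iff.2 (hWL x), Submodule.inner_starProjection_left_eq_right]
  change _ = inner ℂ (W x) (projOn L (S y))
  rw [← hW]
  exact (W.inner_map_map x (B y)).symm

lemma exists_lt_conj_projOn_eq {S : H →L[ℂ] H} (hS : S.IsPositive) (hker : S.ker = ⊥)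
    {L : ClosedSubmodule ℂ H} (hL : L.toSubmoduleᗮ ⊓ S.range = ⊥) {M : ClosedSubmodule ℂ H}
    (hM : M ≠ ⊤) (hM' : M.toSubmoduleᗮ ⊓ S.range = ⊥) :
    ∃ L' : ClosedSubmodule ℂ H, L' < L ∧ L'.toSubmoduleᗮ ⊓ S.range = ⊥ ∧
      opSqrt (S ∘L projOn L ∘L S) ∘L projOn M ∘L opSqrt (S ∘L projOn L ∘L S) =
        S ∘L projOn L' ∘L S := by
  obtain ⟨W, hWL, hW⟩ := exists_linearIsometry_conj_projOn hS hker hL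
  have hkerB := ker_opSqrt_conj_projOn hS hker hL
  have hB : (opSqrt (S ∘L projOn L ∘L S)).IsPositive := opSqrt_isPositive _
  set B := opSqrt (S ∘L projOn L ∘L S)
  let L' : ClosedSubmodule ℂ H :=
    ⟨M.toSubmodule.map W.toLinearMap, by
      change IsClosed (W '' (M : Set H))
      exact W.isometry.isClosedEmbedding.isClosedMap _ M.isClosed⟩
  have hinner : ∀ m x, inner ℂ (W m) (S x) = inner ℂ m (B x) := fun m x => by
    rw [← hS.inner_left_eq_inner_right, ← hW, hB.inner_left_eq_inner_right]
  refine ⟨L', ?_, ?_, ?_⟩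
  · refine lt_of_le_of_ne ?_ ?_
    · rintro _ ⟨m, -, rfl⟩
      exact hWL m
    · intro h
      apply hM
      ext x
      refine ⟨fun _ => trivial, fun _ => ?_⟩
      have hx : W x ∈ L'.toSubmodule := h ▸ hWL x
      obtain ⟨m, hm, hmx⟩ := hx
      exact W.injective hmx ▸ hm
  · rw [Submodule.eq_bot_iff]
    rintro _ ⟨hx, x, rfl⟩
    -- S x ⊥ W(M) means B x ⊥ M, while B x = S(W x) lies in ran S.
    have h1 : B x ∈ M.toSubmoduleᗮ ⊓ S.range := by
      refine ⟨fun m hm => ?_, W x, (hW x).symm⟩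
      rw [← hinner]
      exact hx _ ⟨m, hm, rfl⟩
    rw [hM'] at h1
    have h2 : x ∈ B.ker := h1
    rw [hkerB] at h2
    have h3 : x = 0 := h2
    simp [h3]
  · ext x
    have key : projOn L' (S x) = W (projOn M (B x)) := by
      refine projOn_eq_of_mem_of_inner_eq_zero
        ⟨_, Submodule.starProjection_apply_mem _ _, rfl⟩ ?_
      rintro _ ⟨m, hm, rfl⟩
      change inner ℂ (W m) _ = 0
      rw [inner_sub_right, hinner, W.inner_map_map, ← inner_sub_right]
      exact Submodule.sub_starProjection_mem_orthogonal _ _ hm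
    simp only [ContinuousLinearMap.comp_apply]
    rw [key, hW]

/-! ### Strong limits and the intersection of the chain -/

/-- Turns convergence of quadratic forms into strong convergence. -/
lemma norm_apply_sq_le_of_isPositive {D : H →L[ℂ] H} (hD : D.IsPositive) (x : H) :
    ‖D x‖ ^ 2 ≤ ‖D‖ * (inner ℂ (D x) x).re := by
  set R := opSqrt D
  have hRp : R.IsPositive := opSqrt_isPositive D
  have hRR : ∀ y, R (R y) = D y := opSqrt_opSqrt_apply hD
  have h1 : (inner ℂ (D x) x).re = ‖R x‖ ^ 2 := by
    rw [← hRR, hRp.inner_left_eq_inner_right, inner_self_eq_norm_sq_to_K]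
    norm_cast
  have h2 : ‖R‖ ^ 2 = ‖D‖ := by
    have h := CStarRing.norm_star_mul_self (x := R)
    rw [hRp.isSelfAdjoint.star_eq] at h
    rw [sq, ← h]
    exact congr(‖$(opSqrt_comp_opSqrt hD)‖)
  rw [h1, ← h2, ← mul_pow, ← hRR]
  gcongr
  exact R.le_opNorm _

/-- A decreasing sequence of positive operators converges strongly. -/
lemma exists_tendsto_of_antitone_isPositive {B : ℕ → H →L[ℂ] H} (hB : Antitone B)
    (hpos : ∀ n, (B n).IsPositive) (x : H) : ∃ y, Tendsto (fun n => B n x) atTop (𝓝 y) := by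
  let a : ℕ → ℝ := fun n => (inner ℂ (B n x) x).re
  have hdiff : ∀ n m, n ≤ m → (B n - B m).IsPositive := fun n m h => hB h
  have hsub : ∀ n m, (inner ℂ ((B n - B m) x) x).re = a n - a m := fun n m => by
    simp [a]
  have ha : Antitone a := fun n m h => by
    have := (hdiff n m h).re_inner_nonneg_left x
    have h' : 0 ≤ (inner ℂ ((B n - B m) x) x).re := this
    rw [hsub] at h'
    linarith
  have hbdd : BddBelow (Set.range a) :=
    ⟨0, by rintro _ ⟨n, rfl⟩; exact (hpos n).re_inner_nonneg_left x⟩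
  have hlim := tendsto_atTop_ciInf ha hbdd
  set l := ⨅ n, a n
  have hl : ∀ n, l ≤ a n := fun n => ciInf_le hbdd n
  have hest : ∀ N n m, N ≤ n → n ≤ m →
      dist (B n x) (B m x) ≤ √(‖B 0‖ * (a N - l)) := fun N n m hN h => by
    rw [dist_eq_norm]
    refine Real.le_sqrt_of_sq_le ?_
    have hDn : ‖B n - B m‖ ≤ ‖B 0‖ := by
      refine CStarAlgebra.norm_le_norm_of_nonneg_of_le
        ((ContinuousLinearMap.nonneg_iff_isPositive _).2 (hdiff n m h)) ?_
      refine le_trans ?_ (hB (Nat.zero_le n))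
      exact sub_le_self _ ((ContinuousLinearMap.nonneg_iff_isPositive _).2 (hpos m))
    calc ‖B n x - B m x‖ ^ 2 ≤ ‖B n - B m‖ * (a n - a m) := by
          rw [← hsub]; exact norm_apply_sq_le_of_isPositive (hdiff n m h) x
      _ ≤ ‖B 0‖ * (a N - l) := by
          have h1 := ha hN
          have h2 := hl m
          have h3 : 0 ≤ a n - a m := sub_nonneg.2 (ha h)
          gcongr
  refine cauchySeq_tendsto_of_complete
    (cauchySeq_of_le_tendsto_0 (fun N => √(‖B 0‖ * (a N - l))) (fun n m N hn hm => ?_) ?_)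
  · rcases le_total n m with h | h
    · exact hest N n m hn h
    · rw [dist_comm]; exact hest N m n hm h
  · have : Tendsto (fun N => √(‖B 0‖ * (a N - l))) atTop (𝓝 √(‖B 0‖ * (l - l))) :=
      ((hlim.sub_const l).const_mul _).sqrt
    simpa using this

/-- A symmetric operator norm-dominated by `S` has range contained in that of `S`. -/
lemma range_le_range_of_norm_le {S B : H →L[ℂ] H} (hS : S.IsPositive) (hker : S.ker = ⊥)
    (hB : (B : H →ₗ[ℂ] H).IsSymmetric) (h : ∀ x, ‖B x‖ ≤ ‖S x‖) : B.range ≤ S.range := by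
  -- C S = B on H, so taking adjoints B = S C*.
  let C : H →L[ℂ] H := (B : H →ₗ[ℂ] H).extendOfNorm (S : H →ₗ[ℂ] H)
  have hC : ∀ x, C (S x) = B x :=
    LinearMap.extendOfNorm_eq (denseRange_of_ker_eq_bot hS hker)
      ⟨1, fun x => by rw [one_mul]; exact h x⟩
  rintro _ ⟨x, rfl⟩
  refine ⟨C.adjoint x, ext_inner_right ℂ fun y => ?_⟩
  change inner ℂ (S (C.adjoint x)) y = inner ℂ (B x) y
  rw [hS.inner_left_eq_inner_right, ContinuousLinearMap.adjoint_inner_left, hC]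
  exact (hB x y).symm

lemma opSqrt_conj_projOn_mono {S : H →L[ℂ] H} (hS : S.IsPositive) {L L' : ClosedSubmodule ℂ H}
    (h : L' ≤ L) : opSqrt (S ∘L projOn L' ∘L S) ≤ opSqrt (S ∘L projOn L ∘L S) := by
  refine CFC.sqrt_le_sqrt _ _ ?_
  have h1 : projOn L' ≤ projOn L := Submodule.starProjection_le_starProjection_iff.2 h
  exact conjugate_le_conjugate_of_nonneg h1 ((ContinuousLinearMap.nonneg_iff_isPositive _).2 hS)

lemma iInf_eq_bot_of_conj_projOn_eq {S : H →L[ℂ] H} (hS : S.IsPositive) (hker : S.ker = ⊥)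
    {M : ClosedSubmodule ℂ H} (hM : M.toSubmodule ⊓ S.range = ⊥) {L : ℕ → ClosedSubmodule ℂ H}
    (hL : Antitone L)
    (hstep : ∀ k, opSqrt (S ∘L projOn (L k) ∘L S) ∘L projOn M ∘L
      opSqrt (S ∘L projOn (L k) ∘L S) = S ∘L projOn (L (k + 1)) ∘L S) :
    ⨅ k, L k = ⊥ := by
  let B : ℕ → H →L[ℂ] H := fun k => opSqrt (S ∘L projOn (L k) ∘L S)
  have hBpos : ∀ k, (B k).IsPositive := fun k => opSqrt_isPositive _
  have hBanti : Antitone B := fun i j h => opSqrt_conj_projOn_mono hS (hL h)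
  have hBnorm : ∀ k x, ‖B k x‖ = ‖projOn (L k) (S x)‖ := fun k => norm_opSqrt_conj_projOn hS (L k)
  have hBM : ∀ k x, ‖projOn M (B k x)‖ = ‖B (k + 1) x‖ := fun k x => by
    rw [← norm_opSqrt_conj_projOn (hBpos k), hstep]
  choose f hf using exists_tendsto_of_antitone_isPositive hBanti hBpos
  let G : H →L[ℂ] H := continuousLinearMapOfTendsto B (tendsto_pi_nhds.2 hf)
  have hG : ∀ x, Tendsto (fun n => B n x) atTop (𝓝 (G x)) := hf
  have hGsymm : (G : H →ₗ[ℂ] H).IsSymmetric := fun x y => by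
    refine tendsto_nhds_unique ((hG x).inner tendsto_const_nhds)
      ((tendsto_const_nhds.inner (hG y)).congr fun n => ?_)
    exact ((hBpos n).inner_left_eq_inner_right x y).symm
  have hGle : ∀ x, ‖G x‖ ≤ ‖S x‖ := fun x =>
    le_of_tendsto (hG x).norm (Eventually.of_forall fun n => by
      rw [hBnorm]; exact Submodule.norm_starProjection_apply_le _ _)
  -- In the limit ‖P_M G x‖ = ‖G x‖, which characterises membership in M.
  have hGM : ∀ x, G x ∈ M.toSubmodule := fun x => by
    rw [Submodule.mem_iff_norm_starProjection]
    refine (tendsto_nhds_unique (((projOn M).continuous.tendsto _).comp (hG x)).norm ?_)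
    exact (((tendsto_add_atTop_iff_nat 1).2 (hG x)).norm).congr fun n => (hBM n x).symm
  have hG0 : ∀ x, G x = 0 := fun x => by
    have h : G x ∈ M.toSubmodule ⊓ S.range :=
      ⟨hGM x, range_le_range_of_norm_le hS hker hGsymm hGle ⟨x, rfl⟩⟩
    rwa [hM] at h
  rw [eq_bot_iff]
  intro y hy
  have hy' : ∀ k, y ∈ L k := ClosedSubmodule.mem_iInf.1 hy
  change y = 0
  refine (denseRange_of_ker_eq_bot hS hker).eq_zero_of_inner_left (𝕜 := ℂ) ?_
  intro x
  have hle : ∀ k, ‖inner ℂ y (S x)‖ ≤ ‖y‖ * ‖B k x‖ := fun k => by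
    rw [hBnorm]
    refine le_trans (le_of_eq ?_) (norm_inner_le_norm (𝕜 := ℂ) y (projOn (L k) (S x)))
    rw [projOn, ← Submodule.inner_starProjection_left_eq_right,
      Submodule.starProjection_eq_self_iff.2 (hy' k)]
  have h0 : Tendsto (fun k => ‖y‖ * ‖B k x‖) atTop (𝓝 0) := by
    have := (hG x).norm.const_mul ‖y‖
    simpa [hG0 x] using this
  exact norm_le_zero_iff.1 (ge_of_tendsto h0 (Eventually.of_forall hle))

end

/-! ### Assembly of the chain -/

theorem theorem3p9 {H : Type*} [NormedAddCommGroup H] [InnerProductSpace ℂ H] [CompleteSpace H]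
    [TopologicalSpace.SeparableSpace H] (A : H →L[ℂ] H) (hA : IsNonsingularPositive A)
    (hran : A.range ≠ ⊤) :
    -- `N k` is the subspace with index `k + 1`
    ∃ (M : ClosedSubmodule ℂ H) (N : ℕ → ClosedSubmodule ℂ H),
      StrictMono N ∧
      (∀ k, HasTrivialIntersections A (N k)) ∧
      (⨅ k, (N k)ᗮ) = ⊥ ∧
      (∀ x : H, Tendsto (fun k => projOn (N k) x) atTop (𝓝 x)) ∧
      HasTrivialIntersections A M ∧
      N 0 = Mᗮ ∧
      (∀ k, iterOp A M (k + 1) = opSqrt A ∘L projOn (N k)ᗮ ∘L opSqrt A) := by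
  obtain ⟨hpos, hkerA⟩ := hA
  have hS : (opSqrt A).IsPositive := opSqrt_isPositive A
  have hSS : ∀ x, opSqrt A (opSqrt A x) = A x := opSqrt_opSqrt_apply hpos
  have hker : (opSqrt A).ker = ⊥ := by
    rw [eq_bot_iff, ← hkerA]
    intro x (hx : opSqrt A x = 0)
    change A x = 0
    rw [← hSS, hx, map_zero]
  have hranS : (opSqrt A).range ≠ ⊤ := fun h => by
    have hsurj : Function.Surjective (opSqrt A) := LinearMap.range_eq_top.1 h
    exact hran (LinearMap.range_eq_top.2 fun y => by
      obtain ⟨z, rfl⟩ := hsurj y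
      obtain ⟨x, rfl⟩ := hsurj z
      exact ⟨x, (hSS x).symm⟩)
  obtain ⟨M, hM, hM'⟩ := exists_closedSubmodule_inf_range_eq_bot hS hker hranS
  have hMtop : M ≠ ⊤ := fun h => by
    rw [h, ClosedSubmodule.toSubmodule_top, top_inf_eq] at hM
    have h0 : ∀ x, opSqrt A x = 0 := fun x => by
      have : opSqrt A x ∈ (opSqrt A).range := ⟨x, rfl⟩
      rwa [hM] at this
    refine hranS (eq_top_iff.2 fun x _ => ?_)
    have hx : x ∈ (opSqrt A).ker := h0 x
    rw [hker] at hx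
    have hx : x = 0 := hx
    exact hx ▸ zero_mem _
  let X := {L : ClosedSubmodule ℂ H // L.toSubmoduleᗮ ⊓ (opSqrt A).range = ⊥}
  have step : ∀ L : X, ∃ L' : X, L'.1 < L.1 ∧
      opSqrt (opSqrt A ∘L projOn L.1 ∘L opSqrt A) ∘L projOn M ∘L
        opSqrt (opSqrt A ∘L projOn L.1 ∘L opSqrt A) =
        opSqrt A ∘L projOn L'.1 ∘L opSqrt A := fun L => by
    obtain ⟨L', h1, h2, h3⟩ := exists_lt_conj_projOn_eq hS hker L.2 hMtop hM'
    exact ⟨⟨L', h2⟩, h1, h3⟩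
  choose next hlt hnext using step
  -- Starting at `M` rather than `⊤` makes `L k` encode A_{k+1}.
  let L : ℕ → X := fun n => Nat.rec ⟨M, hM'⟩ (fun _ L => next L) n
  have hanti : StrictAnti fun k => (L k).1 := strictAnti_nat_of_succ_lt fun k => hlt (L k)
  have hiter : ∀ k, iterOp A M (k + 1) = opSqrt A ∘L projOn (L k).1 ∘L opSqrt A := fun k => by
    induction k with
    | zero => rfl
    | succ k ih =>
      rw [iterOp, ih]
      exact hnext (L k)
  have hinf : ⨅ k, (L k).1 = ⊥ :=
    iInf_eq_bot_of_conj_projOn_eq hS hker hM hanti.antitone fun k => hnext (L k)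
  have hperp : ∀ K : ClosedSubmodule ℂ H, Kᗮᗮ = K := fun K => K.orthogonal_orthogonal_eq
  have hmono : StrictMono fun k => ((L k).1)ᗮ := fun i j hij =>
    lt_of_le_of_ne (ClosedSubmodule.orthogonal_le (hanti hij).le) fun h =>
      (hanti hij).ne (by
        have := congrArg ClosedSubmodule.orthogonal h
        rw [hperp, hperp] at this
        exact this.symm)
  refine ⟨M, fun k => ((L k).1)ᗮ, hmono, fun k => ⟨(L k).2, ?_⟩, ?_, fun x => ?_, ⟨hM, hM'⟩,
    rfl, fun k => ?_⟩
  · rw [hperp]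
    -- Every `L k` lies in `L 0`, which is `M`.
    exact eq_bot_mono (inf_le_inf_right _ (hanti.antitone (Nat.zero_le k))) hM
  · simp_rw [hperp]
    exact hinf
  · refine Submodule.starProjection_tendsto_self (fun k => ((L k).1)ᗮ.toSubmodule)
      hmono.monotone x ?_
    rw [top_le_iff, Submodule.topologicalClosure_eq_top_iff, ← Submodule.iInf_orthogonal]
    have h : ∀ k, ((L k).1)ᗮ.toSubmoduleᗮ = (L k).1.toSubmodule := fun k =>
      congrArg ClosedSubmodule.toSubmodule (hperp (L k).1)
    simp_rw [h]
    rw [← ClosedSubmodule.toSubmodule_iInf, hinf]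
    rfl
  · rw [hperp]
    exact hiter k
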